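/- **Setting.** Let $\{\psi_{lk}: l\ge 0,\ 0\le k<N_l\}$ be an orthonormal (wavelet-type) basis of $L^2=L^2([0,1])$ with $N_l\le C\,2^l$ basis functions at level $l$, for some constant $C$. For $\delta>1/2$ let $H(\delta)$ be the Hilbert space of coefficient arrays $x=(x_{lk})$ with $$\|x\|_{H(\delta)}^2:=\sum_{l\ge 0}(l\vee 1)^{-2\delta}2^{-l}\sum_{k}x_{lk}^2<\infty ,$$ which contains $L^2$ through $f\mapsto(\langle\psi_{lk},f\rangle)_{l,k}$. Let $\mathcal N$ be the canonical Gaussian measure on $H(\delta)$, i.e. the law on $H(\delta)$ of $\mathbb W=(w_{lk})$ with $w_{lk}$ i.i.d. $N(0,1)$. For $f\in L^2$ and $n\ge1$ let $P_f^{(n)}$ be the law on $H(\delta)$ of $\mathbb X=f+\mathbb W/\sqrt n$ (Gaussian white noise model). Let $\Pi$ be a prior probability distribution on $L^2$, let $\Pi_n=\Pi(\cdot\,|\,\mathbb X)$ be the posterior distribution on $L^2$, that is, the conditional law of $f$ given $\mathbb X$ when $f\sim\Pi$ and $\mathbb X\,|\,f\sim P_f^{(n)}$, and fix $f_0\in L^2$,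 $P_0=P_{f_0}^{(n)}$, with expectation $E_0$. For a metric space $S$ the bounded Lipschitz metric between Borel probability measures is $\beta_S(\mu,\nu)=\sup_u|\int u\,d\mu-\int u\,d\nu|$, the supremum being over all $u:S\to\mathbb R$ with $\sup_s|u(s)|+\sup_{s\ne t}|u(s)-u(t)|/d(s,t)\le1$. **Theorem (weak nonparametric Bernstein–von Mises in $H(\delta)$).** Let $\delta>\delta'>1/2$ and assume: 1. (Tightness at rate $1/\sqrt n$ in $H(\delta')$.) For every $\varepsilon>0$ there is $0<M<\infty$, independent of $n$, such that for all $n\ge1$, $$E_0\,\Pi\big(\{f:\|f-f_0\|_{H(\delta')}^2>M/n\}\,\big|\,\mathbb X\big)\le\varepsilon .$$ 2. (Finite-dimensional BvM.) For every linear span $V$ of finitely many basis functions $\psi_{lk}$, with the $L^2$-norm and with $\pi_V$ the projection onto $V$ (retaining the coefficients of the basis functions that span $V$), the image $\Pi_n\circ T_{\mathbb X,V}^{-1}$ of $\Pi_n$ under $T_{\mathbb X,V}:f\mapsto\sqrt n\,\pi_V(f-\mathbb X)$ satisfies $\beta_V(\Pi_n\circ T_{\mathbb X,V}^{-1},N(0,I))\to0$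 in $P_0$-probability as $n\to\infty$, where $N(0,I)$ is the standard Gaussian law on $V$. Then, for $\tau_{\mathbb X}:f\mapsto\sqrt n\,(f-\mathbb X)$, $$\beta_{H(\delta)}(\Pi_n\circ\tau_{\mathbb X}^{-1},\mathcal N)\to0\quad\text{in }P_0\text{-probability, as }n\to\infty .$$ -/

import Mathlib

open MeasureTheory ProbabilityTheory Filter Topology
open scoped RealInnerProductSpace ENNReal

noncomputable section

namespace WeakBvM

/-- The space `L²([0,1])` of (classes of) square integrable real functions on `[0,1]`. -/
abbrev L2 : Type := Lp ℝ 2 (volume.restrict (Set.Icc (0 : ℝ) 1))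

instance : MeasurableSpace L2 := borel L2

instance : BorelSpace L2 := ⟨rfl⟩

/-- Index set of a multiscale basis: pairs `(l, k)` with level `l ≥ 0` and position
`0 ≤ k < N l`, where `N l` is the number of basis functions at level `l`. -/
abbrev Idx (N : ℕ → ℕ) : Type := Σ l : ℕ, Fin (N l)

/-- The weight `l^{-2δ} 2^{-l}` at level `l`, with `l` replaced by `1` when `l = 0`. -/
def weight (δ : ℝ) (l : ℕ) : ℝ := (max (l : ℝ) 1) ^ (-2 * δ) * (2 : ℝ) ^ (-(l : ℝ))

lemma weight_pos (δ : ℝ) (l : ℕ) : 0 < weight δ l := by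
  unfold weight; positivity

lemma weight_le_one {δ : ℝ} (hδ : 0 ≤ δ) (l : ℕ) : weight δ l ≤ 1 := by
  unfold weight
  have h1 : (max (l : ℝ) 1) ^ (-2 * δ) ≤ 1 :=
    Real.rpow_le_one_of_one_le_of_nonpos (le_max_right _ _) (by linarith)
  have h2 : (2 : ℝ) ^ (-(l : ℝ)) ≤ 1 :=
    Real.rpow_le_one_of_one_le_of_nonpos (by norm_num) (by simp)
  exact mul_le_one₀ h1 (by positivity) h2

lemma summable_weight_mul {N : ℕ → ℕ} {δ : ℝ} {x y : Idx N → ℝ}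
    (hx : Summable fun i => weight δ i.1 * x i ^ 2)
    (hy : Summable fun i => weight δ i.1 * y i ^ 2) :
    Summable fun i => weight δ i.1 * (x i * y i) := by
  refine Summable.of_norm_bounded (hx.add hy) fun i => ?_
  have hw := (weight_pos δ i.1).le
  rw [Real.norm_eq_abs, abs_mul, abs_of_nonneg hw, ← mul_add]
  refine mul_le_mul_of_nonneg_left ?_ hw
  rw [abs_le]
  constructor <;> nlinarith [sq_nonneg (x i + y i), sq_nonneg (x i - y i), sq_nonneg (x i),
    sq_nonneg (y i)]

/-- The coefficient arrays `(x_{lk})` with `∑_l l^{-2δ} 2^{-l} ∑_k x_{lk}² < ∞`. -/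
def logSobolevSubmodule (N : ℕ → ℕ) (δ : ℝ) : Submodule ℝ (Idx N → ℝ) where
  carrier := {x | Summable fun i : Idx N => weight δ i.1 * x i ^ 2}
  zero_mem' := by simp
  add_mem' := by
    intro x y hx hy
    have h := (hx.add hy).add ((summable_weight_mul hx hy).mul_left 2)
    refine h.congr fun i => ?_
    simp only [Pi.add_apply]; ring
  smul_mem' := by
    intro c x hx
    refine (Summable.mul_left (c ^ 2) hx).congr fun i => ?_
    simp only [Pi.smul_apply, smul_eq_mul]; ring

/-- The logarithmic Sobolev space `H(δ) = H_2^{-1/2,δ}` of order `-1/2`; an element is given by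
its array of coefficients on the basis. It is a type of its own because its topology is the one of
the norm below, not the one of pointwise convergence. -/
def LogSobolev (N : ℕ → ℕ) (δ : ℝ) : Type := logSobolevSubmodule N δ

namespace LogSobolev

variable {N : ℕ → ℕ} {δ : ℝ}

instance : AddCommGroup (LogSobolev N δ) :=
  inferInstanceAs (AddCommGroup (logSobolevSubmodule N δ))

instance : Module ℝ (LogSobolev N δ) :=
  inferInstanceAs (Module ℝ (logSobolevSubmodule N δ))

/-- The `(l, k)`-th coefficient. -/
def coord (x : LogSobolev N δ) (i : Idx N) : ℝ := x.1 i

lemma ext_coord {x y : LogSobolev N δ} (h : ∀ i, x.coord i = y.coord i) : x = y :=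
  Subtype.ext (funext h)

lemma summable_coord (x : LogSobolev N δ) :
    Summable fun i : Idx N => weight δ i.1 * x.coord i ^ 2 := x.2

@[simp] lemma coord_zero (i : Idx N) : (0 : LogSobolev N δ).coord i = 0 := rfl

@[simp] lemma coord_add (x y : LogSobolev N δ) (i : Idx N) :
    (x + y).coord i = x.coord i + y.coord i := rfl

@[simp] lemma coord_sub (x y : LogSobolev N δ) (i : Idx N) :
    (x - y).coord i = x.coord i - y.coord i := rfl

@[simp] lemma coord_smul (c : ℝ) (x : LogSobolev N δ) (i : Idx N) :
    (c • x).coord i = c * x.coord i := rfl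

/-- The inner product `⟨x, y⟩ = ∑_l l^{-2δ} 2^{-l} ∑_k x_{lk} y_{lk}`. -/
abbrev innerCore (N : ℕ → ℕ) (δ : ℝ) : InnerProductSpace.Core ℝ (LogSobolev N δ) where
  inner x y := ∑' i : Idx N, weight δ i.1 * (x.coord i * y.coord i)
  conj_inner_symm x y := by
    simp [mul_comm]
  re_inner_nonneg x := by
    simp only [RCLike.re_to_real]
    exact tsum_nonneg fun i => mul_nonneg (weight_pos δ i.1).le (mul_self_nonneg _)
  add_left x y z := by
    rw [← Summable.tsum_add (summable_weight_mul x.summable_coord z.summable_coord)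
      (summable_weight_mul y.summable_coord z.summable_coord)]
    refine tsum_congr fun i => ?_
    rw [coord_add]; ring
  smul_left x y r := by
    rw [conj_trivial, ← tsum_mul_left]
    refine tsum_congr fun i => ?_
    rw [coord_smul]; ring
  definite x hx := by
    have hnn : ∀ i : Idx N, 0 ≤ weight δ i.1 * (x.coord i * x.coord i) :=
      fun i => mul_nonneg (weight_pos δ i.1).le (mul_self_nonneg _)
    have h := ((summable_weight_mul x.summable_coord x.summable_coord).hasSum_iff.2 hx)
    have h0 := (hasSum_zero_iff_of_nonneg hnn).1 h
    refine ext_coord fun i => ?_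
    have hi := congrFun h0 i
    simpa [(weight_pos δ i.1).ne'] using hi

instance : NormedAddCommGroup (LogSobolev N δ) := (innerCore N δ).toNormedAddCommGroup

instance : InnerProductSpace ℝ (LogSobolev N δ) := InnerProductSpace.ofCore (innerCore N δ).toCore

instance : MeasurableSpace (LogSobolev N δ) := borel _

instance : BorelSpace (LogSobolev N δ) := ⟨rfl⟩

lemma norm_sq (x : LogSobolev N δ) :
    ‖x‖ ^ 2 = ∑' i : Idx N, weight δ i.1 * x.coord i ^ 2 := by
  rw [← real_inner_self_eq_norm_sq]
  change ∑' i : Idx N, weight δ i.1 * (x.coord i * x.coord i) = _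
  simp only [sq]

/-- The element of `H(δ)` given by an array of coefficients. -/
def ofMem (x : Idx N → ℝ) (h : x ∈ logSobolevSubmodule N δ) : LogSobolev N δ :=
  (⟨x, h⟩ : logSobolevSubmodule N δ)

open Classical in
/-- The element of `H(δ)` with the given coefficients (and `0` for arrays outside `H(δ)`). -/
def ofCoord (δ : ℝ) (x : Idx N → ℝ) : LogSobolev N δ :=
  if h : x ∈ logSobolevSubmodule N δ then ofMem x h else 0

lemma coord_ofCoord {x : Idx N → ℝ} (h : x ∈ logSobolevSubmodule N δ) (i : Idx N) :
    (ofCoord δ x).coord i = x i := by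
  rw [ofCoord, dif_pos h]; rfl

open Classical in
/-- The unit vector with index `i`. -/
def unit (N : ℕ → ℕ) (δ : ℝ) (i : Idx N) : LogSobolev N δ :=
  ofMem (Pi.single i 1) (summable_of_ne_finset_zero (s := {i}) fun j hj => by
    have : j ≠ i := by simpa using hj
    simp [this])

open Classical in
lemma coord_sum_unit (c : Idx N → ℝ) (F : Finset (Idx N)) (j : Idx N) :
    (∑ i ∈ F, c i • unit N δ i).coord j = if j ∈ F then c j else 0 := by
  induction F using Finset.induction_on with
  | empty => simp
  | insert a F ha ih =>
    rw [Finset.sum_insert ha, coord_add, ih, coord_smul]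
    change c a * (Pi.single a 1 : Idx N → ℝ) j + _ = _
    by_cases hja : j = a
    · subst hja; simp [ha]
    · simp [hja]

lemma tendsto_sum_unit (x : LogSobolev N δ) :
    Tendsto (fun F : Finset (Idx N) => ∑ i ∈ F, x.coord i • unit N δ i) atTop (𝓝 x) := by
  classical
  rw [tendsto_iff_norm_sub_tendsto_zero]
  have hsq : ∀ F : Finset (Idx N), ‖∑ i ∈ F, x.coord i • unit N δ i - x‖ ^ 2
      = ∑' i : {i // i ∉ F}, weight δ i.1.1 * x.coord i.1 ^ 2 := by
    intro F
    rw [norm_sq]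
    have h2 : (∑' i : {i // i ∉ F}, weight δ i.1.1 * x.coord i.1 ^ 2)
        = ∑' i, Set.indicator {i | i ∉ F} (fun i : Idx N => weight δ i.1 * x.coord i ^ 2) i :=
      tsum_subtype {i : Idx N | i ∉ F} (fun i : Idx N => weight δ i.1 * x.coord i ^ 2)
    rw [h2]
    refine tsum_congr fun i => ?_
    rw [coord_sub, coord_sum_unit]
    by_cases hi : i ∈ F <;> simp [hi]
  have h0 := tendsto_tsum_compl_atTop_zero (fun i : Idx N => weight δ i.1 * x.coord i ^ 2)
  have h1 := (h0.congr fun F => (hsq F).symm).sqrt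
  simpa using h1

instance : TopologicalSpace.SeparableSpace (LogSobolev N δ) := by
  have hs : TopologicalSpace.IsSeparable
      (closure (Submodule.span ℝ (Set.range (unit N δ)) : Set (LogSobolev N δ))) :=
    ((Set.countable_range _).isSeparable.span).closure
  rw [← TopologicalSpace.isSeparable_univ_iff]
  refine hs.mono fun x _ => mem_closure_of_tendsto (tendsto_sum_unit x) (.of_forall fun F => ?_)
  exact Submodule.sum_mem _ fun i _ => Submodule.smul_mem _ _ (Submodule.subset_span ⟨i, rfl⟩)

instance : SecondCountableTopology (LogSobolev N δ) :=
  UniformSpace.secondCountable_of_separable _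

lemma measurableSet_logSobolevSubmodule (N : ℕ → ℕ) (δ : ℝ) :
    MeasurableSet (logSobolevSubmodule N δ : Set (Idx N → ℝ)) := by
  have : (logSobolevSubmodule N δ : Set (Idx N → ℝ))
      = {x | ∑' i : Idx N, ENNReal.ofReal (weight δ i.1 * x i ^ 2) ≠ ∞} := by
    ext x
    constructor
    · intro hx
      exact Summable.tsum_ofReal_ne_top hx
    · intro hx
      have h := ENNReal.summable_toReal hx
      refine h.congr fun i => ?_
      rw [ENNReal.toReal_ofReal (mul_nonneg (weight_pos δ i.1).le (sq_nonneg _))]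
  rw [this]
  refine (measurableSet_singleton _).compl.preimage (Measurable.tsum fun i => ?_)
  fun_prop

lemma measurable_ofCoord : Measurable (ofCoord δ : (Idx N → ℝ) → LogSobolev N δ) := by
  classical
  refine measurable_of_tendsto_metrizable' (atTop : Filter (Finset (Idx N)))
    (f := fun F x => (logSobolevSubmodule N δ : Set (Idx N → ℝ)).indicator
      (fun x => ∑ i ∈ F, x i • unit N δ i) x) (fun F => ?_) ?_
  · refine Measurable.indicator ?_ (measurableSet_logSobolevSubmodule N δ)
    exact Finset.measurable_sum _ fun i _ => (measurable_pi_apply i).smul_const _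
  · rw [tendsto_pi_nhds]
    intro x
    by_cases hx : x ∈ logSobolevSubmodule N δ
    · have h := tendsto_sum_unit (ofCoord δ x)
      refine h.congr fun F => ?_
      rw [Set.indicator_of_mem (by exact hx)]
      exact Finset.sum_congr rfl fun i _ => by rw [coord_ofCoord hx]
    · have h1 : ofCoord δ x = 0 := by rw [ofCoord, dif_neg hx]
      rw [h1]
      refine tendsto_const_nhds.congr fun F => ?_
      rw [Set.indicator_of_notMem (by exact hx)]

end LogSobolev

/-- The canonical Gaussian measure `𝒩` on `H(δ)`: the law of the white noise `𝕎`, whose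
coefficients are independent standard Gaussian variables. -/
def whiteNoise (N : ℕ → ℕ) (δ : ℝ) : Measure (LogSobolev N δ) :=
  (Measure.infinitePi fun _ : Idx N => gaussianReal 0 1).map (LogSobolev.ofCoord δ)

instance (N : ℕ → ℕ) (δ : ℝ) : IsProbabilityMeasure (whiteNoise N δ) :=
  Measure.isProbabilityMeasure_map LogSobolev.measurable_ofCoord.aemeasurable

section Model

variable {N : ℕ → ℕ} (ψ : HilbertBasis (Idx N) ℝ L2) (δ : ℝ)

/-- The injection `L² → H(δ)`, `f ↦ (⟨ψ_{lk}, f⟩)_{l,k}`. -/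
def incl (f : L2) : LogSobolev N δ := LogSobolev.ofCoord δ fun i => ⟪ψ i, f⟫

/-- For `δ ≥ 0` (in particular for `δ > 1/2`) coefficients of `L²` functions do lie in `H(δ)`. -/
lemma coord_incl {δ : ℝ} (hδ : 0 ≤ δ) (f : L2) (i : Idx N) :
    (incl ψ δ f).coord i = ⟪ψ i, f⟫ := by
  refine LogSobolev.coord_ofCoord ?_ i
  have h := (ψ.orthonormal).inner_products_summable (x := f)
  refine Summable.of_nonneg_of_le (fun i => mul_nonneg (weight_pos δ i.1).le (sq_nonneg _))
    (fun i => ?_) h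
  rw [Real.norm_eq_abs, sq_abs]
  exact mul_le_of_le_one_left (sq_nonneg _) (weight_le_one hδ i.1)

lemma measurable_incl : Measurable (incl ψ δ) := by
  refine LogSobolev.measurable_ofCoord.comp (measurable_pi_iff.2 fun i => ?_)
  exact (continuous_const.inner continuous_id).measurable

/-- The Gaussian white noise model with `n` "observations", viewed in `H(δ)`: the kernel that
sends `f ∈ L²` to the law `P_f^{(n)}` of `𝕏 = f + 𝕎 / √n`, with `𝕎 ∼ 𝒩`. -/
def gwn (n : ℕ) : Kernel L2 (LogSobolev N δ) :=
  (Kernel.id ×ₖ Kernel.const L2 (whiteNoise N δ)).map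
    fun p : L2 × LogSobolev N δ => incl ψ δ p.1 + (1 / √(n : ℝ)) • p.2

lemma measurable_gwn_map (n : ℕ) : Measurable
    fun p : L2 × LogSobolev N δ => incl ψ δ p.1 + (1 / √(n : ℝ)) • p.2 := by
  have h : Measurable fun p : L2 × LogSobolev N δ => (1 / √(n : ℝ)) • p.2 :=
    measurable_snd.const_smul (1 / √(n : ℝ))
  exact ((measurable_incl ψ δ).comp measurable_fst).add h

instance (n : ℕ) : IsMarkovKernel (gwn ψ δ n) :=
  Kernel.IsMarkovKernel.map _ (measurable_gwn_map ψ δ n)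

/-- `P_f^{(n)}` is the law of `f + 𝕎 / √n`. -/
lemma gwn_apply (n : ℕ) (f : L2) :
    gwn ψ δ n f = (whiteNoise N δ).map fun w => incl ψ δ f + (1 / √(n : ℝ)) • w := by
  rw [gwn, Kernel.map_apply _ (measurable_gwn_map ψ δ n), Kernel.prod_apply, Kernel.id_apply,
    Kernel.const_apply, Measure.dirac_prod,
    Measure.map_map (measurable_gwn_map ψ δ n) measurable_prodMk_left]
  rfl

/-- The posterior distribution `Π(· | 𝕏)` on `L²` for the prior `Π`: the (regular version of the)
conditional law of `f` given `𝕏`, when `f ∼ Π` and `𝕏 | f ∼ P_f^{(n)}`. -/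
def post (prior : Measure L2) [IsFiniteMeasure prior] (n : ℕ) : Kernel (LogSobolev N δ) L2 :=
  haveI : Fact ((2 : ℝ≥0∞) ≠ ∞) := ⟨by norm_num⟩
  posterior (gwn ψ δ n) prior

/-- The transformation `τ_z : f ↦ √n (f - z)`. -/
def tau (n : ℕ) (z h : LogSobolev N δ) : LogSobolev N δ := √(n : ℝ) • (h - z)

/-- The finite-dimensional projection subspace `V` of `L²` spanned by the `ψ_i`, `i ∈ F`. -/
abbrev projSpace (F : Finset (Idx N)) : Submodule ℝ L2 :=
  Submodule.span ℝ (Set.range fun i : F => ψ i)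

instance (F : Finset (Idx N)) : FiniteDimensional ℝ (projSpace ψ F) :=
  FiniteDimensional.span_of_finite ℝ (Set.finite_range _)

/-- The projection `π_V h = ∑_{i ∈ F} h_i ψ_i` of `h ∈ H(δ)` onto `V`. -/
def proj (F : Finset (Idx N)) (h : LogSobolev N δ) : projSpace ψ F :=
  ∑ i : F, h.coord i • (⟨ψ i, Submodule.subset_span ⟨i, rfl⟩⟩ : projSpace ψ F)

/-- The transformation `T_{z,V} : h ↦ √n π_V (h - z)`. -/
def tauProj (F : Finset (Idx N)) (n : ℕ) (z h : LogSobolev N δ) : projSpace ψ F :=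
  √(n : ℝ) • proj ψ δ F (h - z)

end Model

/-- `u` belongs to the unit ball `BL_S(1)`: `sup |u| + Lip(u) ≤ 1`. -/
def IsBL {S : Type*} [MetricSpace S] (u : S → ℝ) : Prop :=
  ∃ M L : ℝ, M + L ≤ 1 ∧ 0 ≤ M ∧ 0 ≤ L ∧ (∀ s, |u s| ≤ M) ∧ ∀ s t, |u s - u t| ≤ L * dist s t

/-- The bounded Lipschitz metric `β_S(μ, ν) = sup_{u ∈ BL_S(1)} |∫ u dμ - ∫ u dν|` between
probability measures. -/
def blDist {S : Type*} [MetricSpace S] [MeasurableSpace S] (μ ν : Measure S) : ℝ :=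
  sSup {r | ∃ u : S → ℝ, IsBL u ∧ r = |∫ s, u s ∂μ - ∫ s, u s ∂ν|}

section Conditions

variable {N : ℕ → ℕ} (ψ : HilbertBasis (Idx N) ℝ L2)

/-- Tightness at rate `1/√n` in `H(δ')`: for every `ε > 0` there is `M > 0` such that
`E_0 Π(f : ‖f - f₀‖²_{H(δ')} > M/n | 𝕏) ≤ ε` for all `n ≥ 1` (data viewed in `H(δ)`). -/
def TightnessCondition (δ δ' : ℝ) (prior : Measure L2) [IsFiniteMeasure prior] (f₀ : L2) : Prop :=
  ∀ ε : ℝ, 0 < ε → ∃ M : ℝ, 0 < M ∧ ∀ n : ℕ, 1 ≤ n →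
    ∫⁻ X, post ψ δ prior n X {f : L2 | M / n < ‖incl ψ δ' f - incl ψ δ' f₀‖ ^ 2} ∂(gwn ψ δ n f₀)
      ≤ ENNReal.ofReal ε

/-- Parametric Bernstein–von Mises for the finite-dimensional projections: for every finite
collection of basis elements with span `V`, `β_V(Π_n ∘ T_{𝕏,V}⁻¹, N(0, I)) → 0` in
`P_0`-probability. -/
def FiniteDimCondition (δ : ℝ) (prior : Measure L2) [IsFiniteMeasure prior] (f₀ : L2) : Prop :=
  ∀ F : Finset (Idx N), ∀ ε : ℝ, 0 < ε →
    Tendsto (fun n : ℕ => gwn ψ δ n f₀ {X | ε < blDist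
      ((post ψ δ prior n X).map fun f => tauProj ψ δ F n X (incl ψ δ f))
      (stdGaussian (projSpace ψ F))}) atTop (𝓝 0)

end Conditions

end WeakBvM

end

namespace WeakBvM

/-! ### Weights -/

/-! Weak convergence in `H(δ)` follows from convergence of finitely many coordinates once the
remaining coordinates are uniformly negligible. Fix a finite index set `F`. A bounded Lipschitz `u`
changes by at most `min 2 ‖x - trunc F x‖` when `x` is replaced by its truncation, and `u` of the
truncation is a bounded Lipschitz function on the span `V` of the `ψ_i`, `i ∈ F`. So the distance on
`H(δ)` is at most the distance on `V` plus two truncation errors (`blDist_le_blDist_proj_add`).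
White noise projects exactly to the standard Gaussian on `V` (`map_proj_whiteNoise`), so the
distance on `V` is the one in the finite-dimensional hypothesis.

The truncation error of white noise vanishes as `F` grows. For the posterior, write `√n (f - 𝕏) = √n
(f - f₀) - √n (𝕏 - f₀)`. The second term is white noise under `P_0`. The first has `H(δ')`-norm at
most `√M` off a set of small posterior mass, and since `δ' < δ` the weights of order `δ` are at most
`η²` times those of order `δ'` outside a large `F`, so its tail is at most `η √M`
(`integral_norm_sub_trunc_tau_le`). These bounds are uniform in `n`: `F` is fixed first, and only
then does `n → ∞`. -/

/-- The factor `2^{-l}` cancels the number of functions at level `l`, which leaves `∑ l^{-2δ}` with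
`2δ > 1`. -/
lemma summable_weight {N : ℕ → ℕ} (hN : ∃ C : ℝ, ∀ l : ℕ, (N l : ℝ) ≤ C * 2 ^ l)
    {δ : ℝ} (hδ : 1 / 2 < δ) : Summable fun i : Idx N => weight δ i.1 := by
  obtain ⟨C, hC⟩ := hN
  rw [summable_sigma_of_nonneg fun i => (weight_pos δ i.1).le]
  refine ⟨fun l => Summable.of_finite, ?_⟩
  have hmax : Summable fun l : ℕ => (max (l : ℝ) 1) ^ (-2 * δ) := by
    refine (summable_congr_atTop ?_).2 (Real.summable_nat_rpow (p := -2 * δ) |>.2 (by linarith))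
    filter_upwards [eventually_ge_atTop 1] with l hl
    rw [max_eq_left (by exact_mod_cast hl)]
  refine Summable.of_nonneg_of_le (fun l => tsum_nonneg fun _ => (weight_pos δ l).le)
    (fun l => ?_) (hmax.mul_left C)
  change ∑' _ : Fin (N l), weight δ l ≤ _
  rw [tsum_const, Nat.card_eq_fintype_card, Fintype.card_fin, nsmul_eq_mul, weight]
  have h2 : (2 : ℝ) ^ l * (2 : ℝ) ^ (-(l : ℝ)) = 1 := by
    rw [Real.rpow_neg two_pos.le, Real.rpow_natCast]
    exact mul_inv_cancel₀ (by positivity)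
  calc (N l : ℝ) * ((max (l : ℝ) 1) ^ (-2 * δ) * (2 : ℝ) ^ (-(l : ℝ)))
      ≤ (C * 2 ^ l) * ((max (l : ℝ) 1) ^ (-2 * δ) * (2 : ℝ) ^ (-(l : ℝ))) :=
        mul_le_mul_of_nonneg_right (hC l) (by positivity)
    _ = C * (max (l : ℝ) 1) ^ (-2 * δ) * (2 ^ l * (2 : ℝ) ^ (-(l : ℝ))) := by ring
    _ = C * (max (l : ℝ) 1) ^ (-2 * δ) := by rw [h2, mul_one]

/-- Outside a finite set of indices, the weights of order `δ` are negligible with respect to those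
of order `δ' < δ`. -/
lemma eventually_weight_le (N : ℕ → ℕ) {δ δ' : ℝ} (hδ : δ' < δ) {η : ℝ} (hη : 0 < η) :
    ∀ᶠ F : Finset (Idx N) in atTop, ∀ i ∉ F, weight δ i.1 ≤ η * weight δ' i.1 := by
  have hlim : Tendsto (fun l : ℕ => (l : ℝ) ^ (-(2 * (δ - δ')))) atTop (𝓝 0) :=
    (tendsto_rpow_neg_atTop (by linarith)).comp tendsto_natCast_atTop_atTop
  -- The ratio of the two weights is `l^{-2(δ-δ')}` only for `l ≥ 1`, where the maximum with `1` in
  -- the weight is `l`.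
  obtain ⟨J, hJ⟩ := eventually_atTop.1
    ((hlim.eventually (gt_mem_nhds hη)).and (eventually_ge_atTop 1))
  refine eventually_atTop.2 ⟨(Finset.range J).sigma fun _ => Finset.univ, fun F hF i hi => ?_⟩
  have hi' : J ≤ i.1 := by
    by_contra h
    exact hi (hF (by simpa using h))
  obtain ⟨h1, h2⟩ := hJ i.1 hi'
  have h3 : (1 : ℝ) ≤ i.1 := by exact_mod_cast h2
  rw [weight, weight, max_eq_left h3, ← mul_assoc]
  refine mul_le_mul_of_nonneg_right ?_ (by positivity)
  calc (i.1 : ℝ) ^ (-2 * δ) = (i.1 : ℝ) ^ (-(2 * (δ - δ'))) * (i.1 : ℝ) ^ (-2 * δ') := by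
        rw [← Real.rpow_add (by linarith)]; ring_nf
    _ ≤ η * (i.1 : ℝ) ^ (-2 * δ') := mul_le_mul_of_nonneg_right h1.le (by positivity)

/-! ### Truncation to finitely many coefficients -/

namespace LogSobolev

variable {N : ℕ → ℕ} {δ δ' : ℝ}

/-- The map that keeps the coefficients with index in `F` and kills the others. -/
noncomputable def trunc (F : Finset (Idx N)) (x : LogSobolev N δ) : LogSobolev N δ :=
  ∑ i ∈ F, x.coord i • unit N δ i

open Classical in
lemma coord_trunc (F : Finset (Idx N)) (x : LogSobolev N δ) (i : Idx N) :
    (trunc F x).coord i = if i ∈ F then x.coord i else 0 :=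
  coord_sum_unit x.coord F i

lemma trunc_sub (F : Finset (Idx N)) (x y : LogSobolev N δ) :
    trunc F (x - y) = trunc F x - trunc F y := by
  simp [trunc, sub_smul, Finset.sum_sub_distrib]

/-- The two arrays may lie in spaces of different orders; the constant is squared because the
comparison is between terms of squared norms. -/
lemma norm_le_of_sq_coord_le {a : ℝ} (ha : 0 ≤ a) (x : LogSobolev N δ) (y : LogSobolev N δ')
    (h : ∀ i, weight δ i.1 * x.coord i ^ 2 ≤ a ^ 2 * (weight δ' i.1 * y.coord i ^ 2)) :
    ‖x‖ ≤ a * ‖y‖ := by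
  refine le_of_sq_le_sq ?_ (by positivity)
  rw [mul_pow, norm_sq, norm_sq, ← tsum_mul_left]
  exact x.summable_coord.tsum_le_tsum h (y.summable_coord.mul_left _)

lemma norm_trunc_le (F : Finset (Idx N)) (x : LogSobolev N δ) : ‖trunc F x‖ ≤ ‖x‖ := by
  classical
  rw [← one_mul ‖x‖]
  refine norm_le_of_sq_coord_le zero_le_one _ _ fun i => ?_
  have := mul_nonneg (weight_pos δ i.1).le (sq_nonneg (x.coord i))
  rw [coord_trunc]
  split_ifs <;> simp [this]

lemma continuous_trunc (F : Finset (Idx N)) :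
    Continuous (trunc F : LogSobolev N δ → LogSobolev N δ) := by
  refine LipschitzWith.continuous (K := 1) (LipschitzWith.of_dist_le_mul fun x y => ?_)
  rw [dist_eq_norm, dist_eq_norm, ← trunc_sub, NNReal.coe_one, one_mul]
  exact norm_trunc_le F _

lemma abs_coord_le (i : Idx N) (x : LogSobolev N δ) :
    |x.coord i| ≤ √(1 / weight δ i.1) * ‖x‖ := by
  have hw := weight_pos δ i.1
  refine abs_le_of_sq_le_sq ?_ (by positivity)
  rw [mul_pow, Real.sq_sqrt (by positivity), norm_sq, one_div, ← div_eq_inv_mul,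
    le_div_iff₀ hw, mul_comm]
  exact x.summable_coord.le_tsum i fun j _ => mul_nonneg (weight_pos δ j.1).le (sq_nonneg _)

lemma continuous_coord (i : Idx N) : Continuous fun x : LogSobolev N δ => x.coord i := by
  refine LipschitzWith.continuous (K := (√(1 / weight δ i.1)).toNNReal)
    (LipschitzWith.of_dist_le_mul fun x y => ?_)
  rw [Real.dist_eq, dist_eq_norm, ← coord_sub, Real.coe_toNNReal _ (Real.sqrt_nonneg _)]
  exact abs_coord_le i _

/-- Here a bound in the stronger norm `H(δ')` becomes smallness of the tail in `H(δ)`; `x` and `y`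
are the same array seen in the two spaces. -/
lemma norm_sub_trunc_le {F : Finset (Idx N)} {η : ℝ} (hη : 0 ≤ η)
    (hF : ∀ i ∉ F, weight δ i.1 ≤ η ^ 2 * weight δ' i.1)
    (x : LogSobolev N δ) (y : LogSobolev N δ') (h : ∀ i, x.coord i = y.coord i) :
    ‖x - trunc F x‖ ≤ η * ‖y‖ := by
  classical
  refine norm_le_of_sq_coord_le hη _ _ fun i => ?_
  rw [coord_sub, coord_trunc, ← mul_assoc, ← h]
  have h0 := (weight_pos δ' i.1).le
  split_ifs with hi
  · rw [sub_self, zero_pow two_ne_zero, mul_zero]; positivity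
  · rw [sub_zero]
    exact mul_le_mul_of_nonneg_right (hF i hi) (sq_nonneg _)

end LogSobolev

/-! ### White noise -/

section WhiteNoise

variable {N : ℕ → ℕ} {δ : ℝ}

lemma lintegral_sq_gaussianReal : ∫⁻ x, ENNReal.ofReal (x ^ 2) ∂(gaussianReal 0 1) = 1 := by
  have h := variance_fun_id_gaussianReal (μ := 0) (v := 1)
  rw [variance_eq_integral measurable_id'.aemeasurable] at h
  simp only [integral_id_gaussianReal, sub_zero] at h
  rw [← ofReal_integral_eq_lintegral_ofReal, h]
  · simp
  · exact (memLp_id_gaussianReal 2).integrable_sq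
  · exact ae_of_all _ fun x => sq_nonneg x

/-- The expected squared norm of the noise is the sum of the weights, which is finite, so the
squared norm is almost surely finite. -/
lemma ae_mem_logSobolevSubmodule (hN : ∃ C : ℝ, ∀ l : ℕ, (N l : ℝ) ≤ C * 2 ^ l)
    (hδ : 1 / 2 < δ) :
    ∀ᵐ x ∂(Measure.infinitePi fun _ : Idx N => gaussianReal 0 1),
      x ∈ logSobolevSubmodule N δ := by
  have hm : ∀ i : Idx N, Measurable fun x : Idx N → ℝ =>
      ENNReal.ofReal (weight δ i.1 * x i ^ 2) := fun i => by fun_prop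
  have hint : ∀ i : Idx N, ∫⁻ x, ENNReal.ofReal (weight δ i.1 * x i ^ 2)
      ∂(Measure.infinitePi fun _ : Idx N => gaussianReal 0 1) = ENNReal.ofReal (weight δ i.1) := by
    intro i
    have h := (measurePreserving_eval_infinitePi (fun _ : Idx N => gaussianReal 0 1) i)
      |>.lintegral_comp (f := fun t : ℝ => ENNReal.ofReal (t ^ 2)) (by fun_prop)
    simp only [Function.eval, lintegral_sq_gaussianReal] at h
    simp_rw [ENNReal.ofReal_mul (weight_pos δ i.1).le]
    rw [lintegral_const_mul _ (by fun_prop), h, mul_one]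
  have hfin : ∫⁻ x, ∑' i : Idx N, ENNReal.ofReal (weight δ i.1 * x i ^ 2)
      ∂(Measure.infinitePi fun _ : Idx N => gaussianReal 0 1) ≠ ∞ := by
    rw [lintegral_tsum fun i => (hm i).aemeasurable]
    simp_rw [hint]
    exact (summable_weight hN hδ).tsum_ofReal_ne_top
  filter_upwards [ae_lt_top (Measurable.tsum hm) hfin] with x hx
  refine (ENNReal.summable_toReal hx.ne).congr fun i => ?_
  rw [ENNReal.toReal_ofReal (mul_nonneg (weight_pos δ i.1).le (sq_nonneg _))]

/-- White noise has small coefficients outside large finite index sets. -/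
lemma tendsto_whiteNoise_norm_sub_trunc {s : ℝ} (hs : 0 < s) :
    Tendsto (fun F : Finset (Idx N) =>
      whiteNoise N δ {w | s ≤ ‖w - LogSobolev.trunc F w‖}) atTop (𝓝 0) := by
  -- Almost sure convergence gives convergence in measure along sequences, and the filter of finite
  -- subsets of a countable set is countably generated.
  refine tendsto_of_seq_tendsto fun u hu => ?_
  have h := tendstoInMeasure_of_tendsto_ae (μ := whiteNoise N δ)
    (f := fun n w => LogSobolev.trunc (u n) w) (g := id)
    (fun n => (LogSobolev.continuous_trunc (u n)).aestronglyMeasurable)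
    (ae_of_all _ fun w => (LogSobolev.tendsto_sum_unit w).comp hu)
  simpa only [id_eq, norm_sub_rev, Function.comp_def] using tendstoInMeasure_iff_norm.1 h s hs

end WhiteNoise

open LogSobolev

/-! ### Bounded Lipschitz functions -/

section BoundedLipschitz

variable {S : Type*} [MetricSpace S]

lemma IsBL.abs_le_one {u : S → ℝ} (hu : IsBL u) (s : S) : |u s| ≤ 1 := by
  obtain ⟨M, L, hML, -, hL, hM, -⟩ := hu
  exact (hM s).trans (by linarith)

lemma IsBL.abs_sub_le {u : S → ℝ} (hu : IsBL u) (s t : S) : |u s - u t| ≤ dist s t := by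
  obtain ⟨M, L, hML, hM0, -, -, hL⟩ := hu
  exact (hL s t).trans (mul_le_of_le_one_left dist_nonneg (by linarith))

lemma IsBL.abs_sub_le_min {u : S → ℝ} (hu : IsBL u) (s t : S) :
    |u s - u t| ≤ min 2 (dist s t) :=
  le_min ((abs_sub _ _).trans (by linarith [hu.abs_le_one s, hu.abs_le_one t])) (hu.abs_sub_le s t)

lemma IsBL.continuous {u : S → ℝ} (hu : IsBL u) : Continuous u :=
  LipschitzWith.continuous (K := 1) (LipschitzWith.of_dist_le_mul fun s t => by
    simpa [Real.dist_eq] using hu.abs_sub_le s t)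

lemma IsBL.comp {T : Type*} [MetricSpace T] {u : S → ℝ} (hu : IsBL u) {φ : T → S}
    (hφ : ∀ s t, dist (φ s) (φ t) ≤ dist s t) : IsBL (u ∘ φ) := by
  obtain ⟨M, L, hML, hM0, hL0, hM, hL⟩ := hu
  exact ⟨M, L, hML, hM0, hL0, fun s => hM _, fun s t =>
    (hL _ _).trans (mul_le_mul_of_nonneg_left (hφ s t) hL0)⟩

lemma isBL_zero : IsBL (fun _ : S => (0 : ℝ)) :=
  ⟨0, 0, by norm_num, le_rfl, le_rfl, by simp, by simp⟩

variable [MeasurableSpace S]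

lemma IsBL.integrable [OpensMeasurableSpace S] {u : S → ℝ} (hu : IsBL u) (μ : Measure S)
    [IsFiniteMeasure μ] : Integrable u μ :=
  Integrable.of_bound hu.continuous.measurable.aestronglyMeasurable 1
    (ae_of_all _ fun s => hu.abs_le_one s)

lemma IsBL.abs_integral_le_one {u : S → ℝ} (hu : IsBL u) (μ : Measure S)
    [IsProbabilityMeasure μ] : |∫ s, u s ∂μ| ≤ 1 := by
  simpa using norm_integral_le_of_norm_le_const (μ := μ) (f := u) (C := 1)
    (ae_of_all _ fun s => hu.abs_le_one s)

lemma IsBL.abs_integral_sub_le_blDist {u : S → ℝ} (hu : IsBL u) (μ ν : Measure S)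
    [IsProbabilityMeasure μ] [IsProbabilityMeasure ν] :
    |∫ s, u s ∂μ - ∫ s, u s ∂ν| ≤ blDist μ ν := by
  have hneg : IsBL fun s => -u s := by
    obtain ⟨M, L, hML, hM0, hL0, hM, hL⟩ := hu
    refine ⟨M, L, hML, hM0, hL0, fun s => by simpa using hM s, fun s t => ?_⟩
    rw [neg_sub_neg, abs_sub_comm]
    exact hL s t
  -- A real `sSup` dominates its elements only when the set is bounded above; two integrals of
  -- functions bounded by `1` differ by at most `2`.
  have hbdd : BddAbove {r | ∃ u : S → ℝ, IsBL u ∧ r = |∫ s, u s ∂μ - ∫ s, u s ∂ν|} := by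
    refine ⟨2, ?_⟩
    rintro r ⟨v, hv, rfl⟩
    exact (abs_sub _ _).trans
      (by linarith [hv.abs_integral_le_one μ, hv.abs_integral_le_one ν])
  exact le_csSup hbdd ⟨u, hu, rfl⟩

lemma blDist_le {μ ν : Measure S} {c : ℝ}
    (h : ∀ u : S → ℝ, IsBL u → |∫ s, u s ∂μ - ∫ s, u s ∂ν| ≤ c) : blDist μ ν ≤ c := by
  -- The zero function shows that the set is nonempty.
  refine csSup_le ⟨_, _, isBL_zero, rfl⟩ ?_
  rintro r ⟨u, hu, rfl⟩
  exact h u hu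

end BoundedLipschitz

/-! ### Comparison with the finite-dimensional projections -/

section Projection

variable {N : ℕ → ℕ} (ψ : HilbertBasis (Idx N) ℝ L2) {δ : ℝ}

/-- The inclusion of the finite-dimensional space `projSpace ψ F` into `H(δ)`. -/
noncomputable def embed (δ : ℝ) (F : Finset (Idx N)) (y : projSpace ψ F) : LogSobolev N δ :=
  ∑ i ∈ F, ⟪ψ i, (y : L2)⟫ • unit N δ i

lemma coe_proj (F : Finset (Idx N)) (h : LogSobolev N δ) :
    (proj ψ δ F h : L2) = ∑ i ∈ F, h.coord i • ψ i := by
  rw [proj, Submodule.coe_sum, ← Finset.sum_coe_sort F fun i => h.coord i • ψ i]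
  rfl

lemma embed_proj (F : Finset (Idx N)) (h : LogSobolev N δ) :
    embed ψ δ F (proj ψ δ F h) = trunc F h := by
  refine Finset.sum_congr rfl fun i hi => ?_
  rw [coe_proj, ψ.orthonormal.inner_right_sum _ hi]

/-- Bessel's inequality together with weights at most `1`. It ensures that test functions on `H(δ)`
pull back to test functions on `V`. -/
lemma dist_embed_le (hδ : 0 ≤ δ) (F : Finset (Idx N)) (y z : projSpace ψ F) :
    dist (embed ψ δ F y) (embed ψ δ F z) ≤ dist y z := by
  classical
  have hsub : embed ψ δ F y - embed ψ δ F z = embed ψ δ F (y - z) := by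
    simp [embed, inner_sub_right, sub_smul, Finset.sum_sub_distrib]
  rw [dist_eq_norm, dist_eq_norm, hsub]
  refine le_of_sq_le_sq ?_ (norm_nonneg _)
  rw [norm_sq, tsum_eq_sum (s := F)]
  · refine (Finset.sum_le_sum fun i hi => ?_).trans
      (ψ.orthonormal.sum_inner_products_le ((y - z : projSpace ψ F) : L2) (s := F))
    rw [embed, coord_sum_unit (fun i => ⟪ψ i, ((y - z : projSpace ψ F) : L2)⟫), if_pos hi,
      Real.norm_eq_abs, sq_abs]
    exact mul_le_of_le_one_left (sq_nonneg _) (weight_le_one hδ _)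
  · intro i hi
    rw [embed, coord_sum_unit (fun i => ⟪ψ i, ((y - z : projSpace ψ F) : L2)⟫), if_neg hi]
    simp

lemma measurable_proj (F : Finset (Idx N)) : Measurable (proj ψ δ F) := by
  have : Continuous (proj ψ δ F) :=
    continuous_finsetSum _ fun i _ => (continuous_coord i.1).smul continuous_const
  exact this.measurable

lemma proj_smul (F : Finset (Idx N)) (c : ℝ) (h : LogSobolev N δ) :
    proj ψ δ F (c • h) = c • proj ψ δ F h := by
  simp [proj, mul_smul, Finset.smul_sum]

/-- The bounded Lipschitz distance on `H(δ)` is controlled by that of the finite-dimensional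
projections and by the mass away from the finite-dimensional space. -/
lemma blDist_le_blDist_proj_add (hδ : 0 ≤ δ) (F : Finset (Idx N)) (μ ν : Measure (LogSobolev N δ))
    [IsProbabilityMeasure μ] [IsProbabilityMeasure ν] :
    blDist μ ν ≤ blDist (μ.map (proj ψ δ F)) (ν.map (proj ψ δ F))
      + ∫ x, min 2 ‖x - trunc F x‖ ∂μ + ∫ x, min 2 ‖x - trunc F x‖ ∂ν := by
  have hm := measurable_proj ψ (δ := δ) F
  have := Measure.isProbabilityMeasure_map (μ := μ) hm.aemeasurable
  have := Measure.isProbabilityMeasure_map (μ := ν) hm.aemeasurable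
  refine blDist_le fun u hu => ?_
  have huF : IsBL (u ∘ embed ψ δ F) := hu.comp (dist_embed_le ψ hδ F)
  -- Since `embed` after `proj` is `trunc`, the integral against the image measure is that of `u` at
  -- the truncated point.
  have key : ∀ (ρ : Measure (LogSobolev N δ)) [IsProbabilityMeasure ρ],
      |∫ x, u x ∂ρ - ∫ y, (u ∘ embed ψ δ F) y ∂(ρ.map (proj ψ δ F))|
        ≤ ∫ x, min 2 ‖x - trunc F x‖ ∂ρ := by
    intro ρ _
    have hcont := continuous_trunc (δ := δ) F
    rw [integral_map hm.aemeasurable huF.continuous.measurable.aestronglyMeasurable]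
    simp only [Function.comp_apply, embed_proj]
    have hi : Integrable (fun x => u (trunc F x)) ρ :=
      Integrable.of_bound (hu.continuous.comp hcont).measurable.aestronglyMeasurable 1
        (ae_of_all _ fun s => hu.abs_le_one _)
    rw [← integral_sub (hu.integrable ρ) hi]
    refine norm_integral_le_of_norm_le (f := fun x => u x - u (trunc F x)) ?_
      (ae_of_all _ fun x => ?_)
    · refine Integrable.of_bound (C := 2) (Continuous.aestronglyMeasurable (by fun_prop))
        (ae_of_all _ fun x => ?_)
      rw [Real.norm_eq_abs, abs_of_nonneg (le_min zero_le_two (norm_nonneg _))]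
      exact min_le_left _ _
    · rw [← dist_eq_norm x, Real.norm_eq_abs]
      exact hu.abs_sub_le_min _ _
  have h1 := abs_le.1 (key μ)
  have h2 := abs_le.1 (key ν)
  have h3 := abs_le.1 (huF.abs_integral_sub_le_blDist (μ.map (proj ψ δ F)) (ν.map (proj ψ δ F)))
  rw [abs_le]
  constructor <;> linarith [h1.1, h1.2, h2.1, h2.2, h3.1, h3.2]

/-- The finite-dimensional projections of white noise are standard Gaussian. -/
lemma map_proj_whiteNoise (hN : ∃ C : ℝ, ∀ l : ℕ, (N l : ℝ) ≤ C * 2 ^ l) (hδ : 1 / 2 < δ)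
    (F : Finset (Idx N)) :
    (whiteNoise N δ).map (proj ψ δ F) = stdGaussian (projSpace ψ F) := by
  have hon : Orthonormal ℝ fun i : F => ψ i := ψ.orthonormal.comp _ Subtype.val_injective
  have hon' : Orthonormal ℝ fun i : F =>
      (⟨ψ i, Submodule.subset_span ⟨i, rfl⟩⟩ : projSpace ψ F) := by
    refine ⟨fun i => hon.1 i, fun i j hij => hon.2 hij⟩
  let b : OrthonormalBasis F ℝ (projSpace ψ F) := OrthonormalBasis.mk hon' (by
    rw [← Submodule.map_le_map_iff_of_injective (projSpace ψ F).injective_subtype,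
      Submodule.map_span, Submodule.map_top, Submodule.range_subtype, ← Set.range_comp]
    exact le_rfl)
  have hsum : Measurable fun x : F → ℝ => ∑ i, x i • b i := by fun_prop
  have hrestr : Measurable (F.restrict : (Idx N → ℝ) → F → ℝ) := Finset.measurable_restrict F
  rw [stdGaussian_eq_map_pi_orthonormalBasis b, whiteNoise,
    Measure.map_map (measurable_proj ψ F) measurable_ofCoord,
    ← Measure.infinitePi_map_restrict (μ := fun _ : Idx N => gaussianReal 0 1)]
  refine Eq.trans ?_ (Measure.map_map hsum hrestr).symm
  refine Measure.map_congr ?_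
  -- Almost surely `ofCoord` does not fall back on its default value `0`, so it keeps the Gaussian
  -- coordinates.
  filter_upwards [ae_mem_logSobolevSubmodule hN hδ] with x hx
  simp only [Function.comp_apply, proj, coord_ofCoord hx, b, OrthonormalBasis.coe_mk,
    Finset.restrict]

end Projection

/-! ### The posterior -/

section Posterior

variable {N : ℕ → ℕ} (ψ : HilbertBasis (Idx N) ℝ L2) {δ δ' : ℝ} (prior : Measure L2)
  [IsProbabilityMeasure prior]

instance (n : ℕ) : IsMarkovKernel (post ψ δ prior n) := by
  have : Fact ((2 : ℝ≥0∞) ≠ ∞) := ⟨by norm_num⟩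
  unfold post
  infer_instance

lemma measurable_tau_incl (n : ℕ) (X : LogSobolev N δ) :
    Measurable fun f => tau δ n X (incl ψ δ f) :=
  ((measurable_incl ψ δ).sub_const X).const_smul (√(n : ℝ))

lemma map_proj_map_tau (n : ℕ) (X : LogSobolev N δ) (F : Finset (Idx N)) :
    ((post ψ δ prior n X).map fun f => tau δ n X (incl ψ δ f)).map (proj ψ δ F)
      = (post ψ δ prior n X).map fun f => tauProj ψ δ F n X (incl ψ δ f) := by
  rw [Measure.map_map (measurable_proj ψ F) (measurable_tau_incl ψ n X)]
  congr 1
  funext f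
  exact proj_smul ψ F _ _

lemma measurableSet_lt_norm_incl (f₀ : L2) (c : ℝ) :
    MeasurableSet {f : L2 | c < ‖incl ψ δ' f - incl ψ δ' f₀‖ ^ 2} :=
  measurableSet_lt measurable_const (((measurable_incl ψ δ').sub_const _).norm.pow_const 2)

/-- Outside the event that `f` is far from `f₀`, the rescaled `f` is close to its projection. -/
lemma integral_norm_sub_trunc_tau_le (hδ' : 0 ≤ δ') (hδ : δ' < δ) (f₀ : L2) {M η : ℝ} (hη : 0 ≤ η)
    {F : Finset (Idx N)} (hF : ∀ i ∉ F, weight δ i.1 ≤ η ^ 2 * weight δ' i.1)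
    {n : ℕ} (hn : 1 ≤ n) (X : LogSobolev N δ) :
    ∫ x, min 2 ‖x - trunc F x‖ ∂((post ψ δ prior n X).map fun f => tau δ n X (incl ψ δ f))
      ≤ 2 * (post ψ δ prior n X).real {f : L2 | M / n < ‖incl ψ δ' f - incl ψ δ' f₀‖ ^ 2}
        + (η * √M + ‖tau δ n (incl ψ δ f₀) X - trunc F (tau δ n (incl ψ δ f₀) X)‖) := by
  set B : Set L2 := {f : L2 | M / n < ‖incl ψ δ' f - incl ψ δ' f₀‖ ^ 2}
  have hB : MeasurableSet B := measurableSet_lt_norm_incl ψ f₀ _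
  set c : ℝ := η * √M + ‖tau δ n (incl ψ δ f₀) X - trunc F (tau δ n (incl ψ δ f₀) X)‖
  have hc : 0 ≤ c := by positivity
  have hcont := continuous_trunc (δ := δ) F
  rw [integral_map (measurable_tau_incl ψ n X).aemeasurable
    (Continuous.aestronglyMeasurable (by fun_prop))]
  have hint : Integrable (fun f => B.indicator (fun _ => (2 : ℝ)) f + c) (post ψ δ prior n X) :=
    ((integrable_const 2).indicator hB).add (integrable_const c)
  -- On `B` the cap `2` is used; off `B` the tail splits into a signal part and a noise part.
  have hle : ∀ f, min 2 ‖tau δ n X (incl ψ δ f) - trunc F (tau δ n X (incl ψ δ f))‖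
      ≤ B.indicator (fun _ => (2 : ℝ)) f + c := by
    intro f
    by_cases hf : f ∈ B
    · rw [Set.indicator_of_mem hf]
      exact (min_le_left _ _).trans (by linarith)
    · rw [Set.indicator_of_notMem hf, zero_add]
      refine (min_le_right _ _).trans ?_
      have hn0 : (0 : ℝ) < n := by exact_mod_cast hn
      have hdiff : tau δ n X (incl ψ δ f)
          = √(n : ℝ) • (incl ψ δ f - incl ψ δ f₀) - tau δ n (incl ψ δ f₀) X := by
        simp only [tau, ← smul_sub]
        congr 1
        abel
      have hfar : ‖√(n : ℝ) • (incl ψ δ' f - incl ψ δ' f₀)‖ ≤ √M := by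
        refine Real.le_sqrt_of_sq_le ?_
        rw [norm_smul, mul_pow, Real.norm_eq_abs, sq_abs, Real.sq_sqrt hn0.le, mul_comm]
        exact (le_div_iff₀ hn0).1 (not_lt.1 hf)
      have hproj := norm_sub_trunc_le hη hF (√(n : ℝ) • (incl ψ δ f - incl ψ δ f₀))
        (√(n : ℝ) • (incl ψ δ' f - incl ψ δ' f₀)) fun i => by
          simp only [coord_smul, coord_sub, coord_incl ψ hδ', coord_incl ψ (hδ'.trans hδ.le)]
      rw [hdiff, trunc_sub, sub_sub_sub_comm]
      exact (norm_sub_le _ _).trans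
        (add_le_add_left (hproj.trans (mul_le_mul_of_nonneg_left hfar hη)) _)
  refine (integral_mono_of_nonneg (ae_of_all _ fun f => le_min zero_le_two (norm_nonneg _)) hint
    (ae_of_all _ hle)).trans (le_of_eq ?_)
  rw [integral_add ((integrable_const 2).indicator hB) (integrable_const c),
    integral_indicator_const _ hB]
  simp [mul_comm]

/-- Under `P_f`, the rescaled noise `√n (𝕏 - f)` is a white noise. -/
lemma map_tau_gwn (f : L2) {n : ℕ} (hn : 1 ≤ n) :
    (gwn ψ δ n f).map (tau δ n (incl ψ δ f)) = whiteNoise N δ := by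
  have hn0 : √(n : ℝ) ≠ 0 := by
    have : (0 : ℝ) < n := by exact_mod_cast hn
    positivity
  have hm : Measurable (tau δ n (incl ψ δ f)) :=
    (measurable_id.sub_const (incl ψ δ f)).const_smul (√(n : ℝ))
  have hm' : Measurable fun w : LogSobolev N δ => incl ψ δ f + (1 / √(n : ℝ)) • w :=
    (measurable_id.const_smul (1 / √(n : ℝ))).const_add _
  rw [gwn_apply, Measure.map_map hm hm']
  have : tau δ n (incl ψ δ f) ∘ (fun w => incl ψ δ f + (1 / √(n : ℝ)) • w) = id := by
    funext w
    simp [tau, smul_smul, hn0]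
  rw [this, Measure.map_id]

/-- The mean truncation error of a probability measure is bounded through its tails. -/
lemma integral_min_norm_sub_trunc_le (ν : Measure (LogSobolev N δ)) [IsProbabilityMeasure ν]
    (F : Finset (Idx N)) {s : ℝ} (hs : 0 ≤ s) :
    ∫ x, min 2 ‖x - trunc F x‖ ∂ν ≤ 2 * ν.real {x | s ≤ ‖x - trunc F x‖} + s := by
  have hcont := continuous_trunc (δ := δ) F
  have hB : MeasurableSet {x : LogSobolev N δ | s ≤ ‖x - trunc F x‖} :=
    measurableSet_le measurable_const (Continuous.measurable (by fun_prop))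
  refine (integral_mono_of_nonneg (ae_of_all _ fun f => le_min zero_le_two (norm_nonneg _))
    (((integrable_const (2 : ℝ)).indicator hB).add (integrable_const s))
    (ae_of_all _ fun x => ?_)).trans (le_of_eq ?_)
  · by_cases hx : s ≤ ‖x - trunc F x‖
    · simp only [Pi.add_apply, Set.indicator, Set.mem_ofPred_eq, hx, if_true]
      exact (min_le_left _ _).trans (by linarith)
    · simp only [Pi.add_apply, Set.indicator, Set.mem_ofPred_eq, hx, if_false, zero_add]
      exact (min_le_right _ _).trans (not_le.1 hx).le
  · simp only [Pi.add_apply]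
    rw [integral_add ((integrable_const 2).indicator hB) (integrable_const s),
      integral_indicator_const _ hB]
    simp [mul_comm]

end Posterior

/-! ### Combining the bounds and controlling the exceptional events -/

section Main

variable {N : ℕ → ℕ} (ψ : HilbertBasis (Idx N) ℝ L2) {δ δ' : ℝ} (prior : Measure L2)
  [IsProbabilityMeasure prior]

/-- The deterministic bound behind the theorem: in `H(δ)`, the posterior is close to white noise
as soon as its finite-dimensional projection is, up to the posterior mass far from `f₀` and the
truncation errors. -/
lemma blDist_tau_le (hN : ∃ C : ℝ, ∀ l : ℕ, (N l : ℝ) ≤ C * 2 ^ l) (hδ' : 1 / 2 < δ')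
    (hδ : δ' < δ) (f₀ : L2) {M η s : ℝ} (hη : 0 ≤ η) (hs : 0 ≤ s) {F : Finset (Idx N)}
    (hF : ∀ i ∉ F, weight δ i.1 ≤ η ^ 2 * weight δ' i.1)
    {n : ℕ} (hn : 1 ≤ n) (X : LogSobolev N δ) :
    blDist ((post ψ δ prior n X).map fun f => tau δ n X (incl ψ δ f)) (whiteNoise N δ)
      ≤ blDist ((post ψ δ prior n X).map fun f => tauProj ψ δ F n X (incl ψ δ f))
          (stdGaussian (projSpace ψ F))
        + (2 * (post ψ δ prior n X).real {f : L2 | M / n < ‖incl ψ δ' f - incl ψ δ' f₀‖ ^ 2}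
          + (η * √M + ‖tau δ n (incl ψ δ f₀) X - trunc F (tau δ n (incl ψ δ f₀) X)‖))
        + (2 * (whiteNoise N δ).real {x | s ≤ ‖x - trunc F x‖} + s) := by
  have := Measure.isProbabilityMeasure_map (μ := post ψ δ prior n X)
    (measurable_tau_incl ψ n X).aemeasurable
  have h := blDist_le_blDist_proj_add ψ (by linarith : (0 : ℝ) ≤ δ) F
    ((post ψ δ prior n X).map fun f => tau δ n X (incl ψ δ f)) (whiteNoise N δ)
  rw [map_proj_map_tau, map_proj_whiteNoise ψ hN (hδ'.trans hδ)] at h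
  have h1 := integral_norm_sub_trunc_tau_le ψ prior (by linarith : (0 : ℝ) ≤ δ') hδ f₀ (M := M)
    hη hF hn X
  have h2 := integral_min_norm_sub_trunc_le (whiteNoise N δ) F hs
  linarith

/-- Markov's inequality for the posterior mass of a set. -/
lemma gwn_le_post_le (f₀ : L2) (n : ℕ) {B : Set L2} (hB : MeasurableSet B) {a b : ℝ} (ha : 0 < a)
    (h : ∫⁻ X, post ψ δ prior n X B ∂(gwn ψ δ n f₀) ≤ ENNReal.ofReal (a * b)) :
    gwn ψ δ n f₀ {X | a ≤ (post ψ δ prior n X).real B} ≤ ENNReal.ofReal b := by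
  have hM := mul_meas_ge_le_lintegral (μ := gwn ψ δ n f₀)
    ((post ψ δ prior n).measurable_coe hB) (ENNReal.ofReal a)
  have hset : {X | a ≤ (post ψ δ prior n X).real B}
      = {X | ENNReal.ofReal a ≤ post ψ δ prior n X B} := by
    ext X
    exact (ENNReal.ofReal_le_iff_le_toReal (measure_ne_top _ _)).symm
  rw [hset]
  have h2 := hM.trans h
  rw [ENNReal.ofReal_mul ha.le] at h2
  exact (ENNReal.mul_le_mul_iff_right (by simpa using ha) ENNReal.ofReal_ne_top).1 h2

end Main
end WeakBvM

theorem mainTheorem9 (N : ℕ → ℕ) (hN : ∃ C : ℝ, ∀ l : ℕ, (N l : ℝ) ≤ C * 2 ^ l)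
    (ψ : HilbertBasis (WeakBvM.Idx N) ℝ WeakBvM.L2)
    (prior : Measure WeakBvM.L2) [IsProbabilityMeasure prior] (f₀ : WeakBvM.L2)
    (δ δ' : ℝ) (hδ' : 1 / 2 < δ') (hδ : δ' < δ)
    (htight : WeakBvM.TightnessCondition ψ δ δ' prior f₀)
    (hfidi : WeakBvM.FiniteDimCondition ψ δ prior f₀) :
    ∀ ε : ℝ, 0 < ε →
      Tendsto (fun n : ℕ => WeakBvM.gwn ψ δ n f₀ {X | ε < WeakBvM.blDist
        ((WeakBvM.post ψ δ prior n X).map fun f => WeakBvM.tau δ n X (WeakBvM.incl ψ δ f))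
        (WeakBvM.whiteNoise N δ)}) atTop (𝓝 0) := by
  open WeakBvM WeakBvM.LogSobolev in
  intro ε hε
  refine ENNReal.tendsto_nhds_zero.2 fun κ hκ => ?_
  -- A finite `k` below `κ`, which may be `∞`, is split into thirds, one for each exceptional event.
  obtain ⟨k, hk0, hkκ⟩ := ENNReal.lt_iff_exists_nnreal_btwn.1 hκ
  have hk : (0 : ℝ) < k := by exact_mod_cast hk0
  -- By Markov's inequality, this product makes the posterior mass reach `ε / 8` with probability at
  -- most `k / 3`.
  obtain ⟨M, hM, hMn⟩ := htight (ε / 8 * (k / 3)) (by positivity)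
  obtain ⟨η, hη, hηM⟩ : ∃ η : ℝ, 0 < η ∧ η * √M ≤ ε / 8 := by
    refine ⟨ε / 8 / √M, by positivity, (div_mul_cancel₀ _ (by positivity)).le⟩
  have hs : 0 < ε / 16 := by positivity
  -- The bound `ε / 16` serves the truncation error of the limit law, and `k / 3` the probability of
  -- a large noise tail in the data.
  have hp : 0 < ENNReal.ofReal (min (ε / 16) (k / 3)) := by
    rw [ENNReal.ofReal_pos]; positivity
  obtain ⟨F, hF, hFp⟩ := ((eventually_weight_le N hδ (pow_pos hη 2)).and
    (ENNReal.tendsto_nhds_zero.1 (tendsto_whiteNoise_norm_sub_trunc (N := N) (δ := δ) hs) _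
      hp)).exists
  have hFp1 : (whiteNoise N δ).real {x | ε / 16 ≤ ‖x - trunc F x‖} ≤ ε / 16 :=
    ENNReal.toReal_le_of_le_ofReal hs.le
      (hFp.trans (ENNReal.ofReal_le_ofReal (min_le_left _ _)))
  have hk3 : (0 : ℝ) < k / 3 := by positivity
  filter_upwards [eventually_ge_atTop 1, ENNReal.tendsto_nhds_zero.1 (hfidi F (ε / 4)
    (by positivity)) (ENNReal.ofReal (k / 3)) (by rwa [gt_iff_lt, ENNReal.ofReal_pos])] with n hn hβ
  have hA := gwn_le_post_le ψ prior f₀ n (measurableSet_lt_norm_incl ψ f₀ (M / n))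
    (by positivity) (hMn n hn)
  have hR : gwn ψ δ n f₀ {X | ε / 16 ≤ ‖tau δ n (incl ψ δ f₀) X
      - trunc F (tau δ n (incl ψ δ f₀) X)‖} ≤ ENNReal.ofReal (k / 3) := by
    have hm : Measurable (tau δ n (incl ψ δ f₀)) :=
      (measurable_id.sub_const (incl ψ δ f₀)).const_smul (√(n : ℝ))
    have hcont := continuous_trunc (δ := δ) F
    refine le_trans (le_of_eq ?_) (hFp.trans (ENNReal.ofReal_le_ofReal (min_le_right _ _)))
    rw [← map_tau_gwn ψ f₀ hn, Measure.map_apply hm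
      (measurableSet_le measurable_const (Continuous.measurable (by fun_prop)))]
    rfl
  -- Off the three events the bound is `ε/4 + 2·ε/8 + ε/8 + ε/16 + (2·ε/16 + ε/16) = 7ε/8 < ε`.
  have hsub : {X | ε < blDist ((post ψ δ prior n X).map fun f => tau δ n X (incl ψ δ f))
        (whiteNoise N δ)}
      ⊆ {X | ε / 4 < blDist ((post ψ δ prior n X).map fun f => tauProj ψ δ F n X (incl ψ δ f))
          (stdGaussian (projSpace ψ F))}
        ∪ {X | ε / 8 ≤ (post ψ δ prior n X).real
            {f : L2 | M / n < ‖incl ψ δ' f - incl ψ δ' f₀‖ ^ 2}}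
        ∪ {X | ε / 16 ≤ ‖tau δ n (incl ψ δ f₀) X - trunc F (tau δ n (incl ψ δ f₀) X)‖} := by
    intro X hX
    by_contra hnot
    simp only [Set.mem_union, Set.mem_ofPred_eq, not_or, not_lt, not_le] at hnot hX
    have h := blDist_tau_le ψ prior hN hδ' hδ f₀ (M := M) hη.le hs.le hF hn X
    linarith [hnot.1.1, hnot.1.2, hnot.2]
  calc gwn ψ δ n f₀ {X | ε < blDist ((post ψ δ prior n X).map fun f => tau δ n X (incl ψ δ f))
        (whiteNoise N δ)}
      ≤ ENNReal.ofReal (k / 3) + ENNReal.ofReal (k / 3) + ENNReal.ofReal (k / 3) :=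
        (measure_mono hsub).trans ((measure_union_le _ _).trans
          (add_le_add ((measure_union_le _ _).trans (add_le_add hβ hA)) hR))
    _ = k := by
        rw [← ENNReal.ofReal_add hk3.le hk3.le, ← ENNReal.ofReal_add (by positivity) hk3.le,
          show (k : ℝ) / 3 + k / 3 + k / 3 = k by ring, ENNReal.ofReal_coe_nnreal]
    _ ≤ κ := hkκ.le
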